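/- Setting. Let $d=2m$ with $m\ge 1$, and write $\mathbb C^{d}=\mathbb C^{m}\otimes\mathbb C^{2}$, with initial basis state $|0\rangle=|0\rangle|0\rangle$. Every unitary $X\in\mathbb C^{d\times d}$ has a unique amplitude $a\in[0,1]$ such that $$X|0\rangle = a\,|\phi_{\rm good}\rangle|0\rangle+\sqrt{1-a^2}\,|\phi_{\rm bad}\rangle|1\rangle$$ for some unit vectors $\phi_{\rm good},\phi_{\rm bad}\in\mathbb C^m$. An algorithm with forward access to $X$ acts on $\mathbb C^d\otimes\mathbb C^{w}$ (with a workspace of arbitrary finite dimension $w\ge 1$), starts in the all-zero basis state, and may adaptively perform finitely many steps, each of which is either a quantum measurement with finitely many outcomes on the joint space, not depending on $X$ (this includes unitary gates and quantum channels), or an application of $X$ to $\mathbb C^d$; at the end it outputs a real number. It may depend on $d$ and $\varepsilon$, but cannot apply $X^\dagger$. Its number of applications of $X$ is the maximum over all measurement outcomes. It solves amplitude estimation to additive error $\varepsilon$ if for every unitary $X\in\mathbb C^{d\times d}$, with amplitude $a$, its output $\hat a$ satisfies $a-\varepsilon<\hat a<a+\varepsilon$ with probability at least $0.99$. Theorem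 1.4. There is a universal constant $c>0$ such that for every even $d\ge 2$ and every $0<\varepsilon\le \tfrac12$, any algorithm with only forward access to a unitary $X\in\mathbb C^{d\times d}$ (no $X^\dagger$) that solves amplitude estimation to additive error $\varepsilon$ uses at least $c\cdot\min(d,1/\varepsilon^2)$ applications of $X$; that is, $\Omega(\min(d,1/\varepsilon^2))$ applications are necessary. -/

import Mathlib

open scoped Matrix Kronecker

noncomputable section

/-- The computational basis state `|0⟩|0⟩` of `ℂ^m ⊗ ℂ^2`. -/
def ketZero (m : ℕ) [NeZero m] : Fin m × Fin 2 → ℂ :=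
  Pi.single (0, 0) 1

/-- `HasAmplitude X a`: there are unit vectors `φ_good`, `φ_bad` in `ℂ^m` with
`X |0⟩ = a |φ_good⟩|0⟩ + √(1 - a²) |φ_bad⟩|1⟩` and `0 ≤ a ≤ 1`.
The second tensor factor is the flag qubit. -/
def HasAmplitude {m : ℕ} [NeZero m] (X : Matrix (Fin m × Fin 2) (Fin m × Fin 2) ℂ) (a : ℝ) :
    Prop :=
  0 ≤ a ∧ a ≤ 1 ∧
    ∃ φgood φbad : EuclideanSpace ℂ (Fin m), ‖φgood‖ = 1 ∧ ‖φbad‖ = 1 ∧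
      ∀ i : Fin m,
        (X *ᵥ ketZero m) (i, 0) = (a : ℂ) * φgood i ∧
        (X *ᵥ ketZero m) (i, 1) = (Real.sqrt (1 - a ^ 2) : ℂ) * φbad i

/-- An adaptive quantum algorithm with forward access to an unknown matrix acting on the
register `ℂ^Q`, with a workspace register `ℂ^W`.

* `output r`: halt and output the real number `r`.
* `measure k K hK next`: perform on the joint register `ℂ^Q ⊗ ℂ^W` the quantum measurement with
  operators `K 0, …, K (k - 1)`, where `∑ i, K i ^† K i = 1`, and continue with `next i` on
  outcome `i`. For `k = 1` this is a unitary gate; ignoring the outcome gives an arbitrary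
  quantum channel, and random choices are measurements as well.
* `query next`: apply the unknown matrix once to the register `ℂ^Q`, and continue with `next`.

There is no way to apply the inverse of the unknown matrix, nor a controlled version of it. -/
inductive ForwardAlgorithm (Q W : Type) [Fintype Q] [DecidableEq Q] [Fintype W]
    [DecidableEq W] : Type
  | output (r : ℝ) : ForwardAlgorithm Q W
  | measure (k : ℕ) (K : Fin k → Matrix (Q × W) (Q × W) ℂ)
      (hK : ∑ i, (K i)ᴴ * K i = 1) (next : Fin k → ForwardAlgorithm Q W) : ForwardAlgorithm Q W
  | query (next : ForwardAlgorithm Q W) : ForwardAlgorithm Q W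

namespace ForwardAlgorithm

variable {Q W : Type} [Fintype Q] [DecidableEq Q] [Fintype W] [DecidableEq W]

/-- The number of applications of the unknown matrix, in the worst case over all
measurement outcomes. -/
def queries : ForwardAlgorithm Q W → ℕ
  | output _ => 0
  | measure _ _ _ next => Finset.univ.sup fun i => (next i).queries
  | query next => next.queries + 1

/-- `alg.prob X S ψ` is the probability that the algorithm, run with the unknown matrix `X` from
the state `ψ`, outputs an element of `S`. States are not renormalized after a measurement, so
that the squared norm of a state is the joint probability of the outcomes that led to it. -/
def prob (X : Matrix Q Q ℂ) (S : Set ℝ) : ForwardAlgorithm Q W → (Q × W → ℂ) → ℝ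
  | output r, ψ => S.indicator (fun _ => ∑ s, ‖ψ s‖ ^ 2) r
  | measure _ K _ next, ψ => ∑ i, (next i).prob X S (K i *ᵥ ψ)
  | query next, ψ => next.prob X S ((X ⊗ₖ (1 : Matrix W W ℂ)) *ᵥ ψ)

/-- The algorithm, started in the state `|0⟩|0⟩` with workspace `|0⟩`, solves amplitude
estimation to additive error `ε`: for every unitary `X` with amplitude `a`, the output lies in
`(a - ε, a + ε)` with probability at least `0.99`. -/
def SolvesAmplitudeEstimation {m w : ℕ} [NeZero m] [NeZero w]
    (alg : ForwardAlgorithm (Fin m × Fin 2) (Fin w)) (ε : ℝ) : Prop :=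
  ∀ X ∈ Matrix.unitaryGroup (Fin m × Fin 2) ℂ, ∀ a : ℝ, HasAmplitude X a →
    99 / 100 ≤ alg.prob X (Set.Ioo (a - ε) (a + ε)) (Pi.single ((0, 0), 0) 1)

end ForwardAlgorithm

end

/-!
The hard unitaries are `X = ∑ i, z i • A i (s i)` with `A i x = |i⟩⟨i| F ⊗ NOT ^ x`, where `F` is a
unitary on `ℂ^m` whose first column has entries of modulus `1 / √m`, the `z i` are independent
uniform roots of unity of order larger than the number `T` of queries, and the `s i` are bits. The
squared amplitude of `X` is the fraction of bits that vanish
(`hasAmplitude_sum_smul_flaggedRow`), so an amplitude estimate reveals the bias of random bits.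

Each branch of an algorithm ends in a state that is a homogeneous polynomial of degree `T` or less
in the phases `z`. With only forward access no `z i` is ever cancelled by its inverse. By
orthogonality of the monomials, averaging over the phases turns the outcome into a mixture over
monomials `n` (`sum_prob_eq_sum_recordWeight`), and the coefficient of a monomial depends only on
the bits `s i` with `n i ≠ 0`, of which there are at most `T` (`recordWeight_congr`,
`recordWeight_eq_zero`). Thus the algorithm is no better than an adaptive procedure that looks at
`T` bits.

For such a procedure the second moment of the likelihood ratio between signs of bias `b` and of bias
`0` is at most `(1 + b²) ^ T`. Indeed `(1 + b σ)² = (1 + b²) (1 + b' σ)` for a sign `σ` and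
`b' = 2 b / (1 + b²)`, and the total probability is one for bias `b'` as well
(`sq_sum_mul_signDensity_sub_le`). Hence telling the two biases apart takes `T ≥ 1 / (4 b²)`.
The fraction of vanishing bits fluctuates by the order of `1 / √m`
(`sum_signDensity_deviation_le`), so an `ε`-estimate of the amplitude separates bias `0` from bias
`b = 8 ε + 8 / √m`, and `1 / b²` is of the order `min m (1 / ε²)`. When this `b` exceeds `1`, the
minimum is bounded and it suffices that at least one query is needed.
-/

/-! ### Output probabilities -/

namespace ForwardAlgorithm

variable {Q W : Type} [Fintype Q] [DecidableEq Q] [Fintype W] [DecidableEq W]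

lemma prob_nonneg (X : Matrix Q Q ℂ) (S : Set ℝ) (alg : ForwardAlgorithm Q W) :
    ∀ ψ : Q × W → ℂ, 0 ≤ alg.prob X S ψ := by
  induction alg with
  | output r =>
    intro ψ
    exact Set.indicator_nonneg (fun _ _ => Finset.sum_nonneg fun _ _ => by positivity) _
  | measure k K hK next ih => exact fun ψ => Finset.sum_nonneg fun i _ => ih i _
  | query next ih => exact fun ψ => ih _

lemma prob_mono (X : Matrix Q Q ℂ) {S S' : Set ℝ} (h : S ⊆ S') (alg : ForwardAlgorithm Q W) :
    ∀ ψ : Q × W → ℂ, alg.prob X S ψ ≤ alg.prob X S' ψ := by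
  induction alg with
  | output r =>
    intro ψ
    exact Set.indicator_le_indicator_of_subset h
      (fun _ => Finset.sum_nonneg fun _ _ => by positivity) _
  | measure k K hK next ih => exact fun ψ => Finset.sum_le_sum fun i _ => ih i _
  | query next ih => exact fun ψ => ih _

lemma prob_union_of_disjoint (X : Matrix Q Q ℂ) {S S' : Set ℝ} (h : Disjoint S S')
    (alg : ForwardAlgorithm Q W) :
    ∀ ψ : Q × W → ℂ, alg.prob X (S ∪ S') ψ = alg.prob X S ψ + alg.prob X S' ψ := by
  induction alg with
  | output r =>
    intro ψ
    simp only [prob]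
    rw [Set.indicator_union_of_disjoint h]
  | measure k K hK next ih =>
    intro ψ
    simp only [prob, ih, Finset.sum_add_distrib]
  | query next ih => exact fun ψ => ih _

lemma sum_norm_sq_eq_dotProduct {ι : Type*} [Fintype ι] (v : ι → ℂ) :
    ((∑ x, ‖v x‖ ^ 2 : ℝ) : ℂ) = star v ⬝ᵥ v := by
  simp [dotProduct, ← Complex.conj_mul']

/-- A family of operators with `∑ Kᵢ† Kᵢ = 1` preserves the total squared norm. -/
lemma sum_norm_sq_mulVec {ι κ : Type*} [Fintype ι] [DecidableEq ι] [Fintype κ]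
    (K : κ → Matrix ι ι ℂ) (hK : ∑ i, (K i)ᴴ * K i = 1) (v : ι → ℂ) :
    ∑ i, ∑ x, ‖(K i *ᵥ v) x‖ ^ 2 = ∑ x, ‖v x‖ ^ 2 := by
  apply Complex.ofReal_injective
  rw [Complex.ofReal_sum]
  simp only [sum_norm_sq_eq_dotProduct]
  calc ∑ i, star (K i *ᵥ v) ⬝ᵥ (K i *ᵥ v) = ∑ i, star v ⬝ᵥ (((K i)ᴴ * K i) *ᵥ v) := by
        refine Finset.sum_congr rfl fun i _ => ?_
        rw [Matrix.star_mulVec, ← Matrix.dotProduct_mulVec, Matrix.mulVec_mulVec]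
    _ = star v ⬝ᵥ v := by
        rw [← dotProduct_sum, ← Matrix.sum_mulVec, hK, Matrix.one_mulVec]

lemma prob_univ {X : Matrix Q Q ℂ} (hX : X ∈ Matrix.unitaryGroup Q ℂ)
    (alg : ForwardAlgorithm Q W) :
    ∀ ψ : Q × W → ℂ, alg.prob X Set.univ ψ = ∑ x, ‖ψ x‖ ^ 2 := by
  induction alg with
  | output r => intro ψ; simp [prob]
  | measure k K hK next ih =>
    intro ψ
    simp only [prob, ih]
    exact sum_norm_sq_mulVec K hK ψ
  | query next ih =>
    intro ψ
    have h := sum_norm_sq_mulVec (fun _ : Unit => X ⊗ₖ (1 : Matrix W W ℂ)) (by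
      rw [Matrix.mem_unitaryGroup_iff', Matrix.star_eq_conjTranspose] at hX
      simp [Matrix.conjTranspose_kronecker, ← Matrix.mul_kronecker_mul, hX]) ψ
    simpa [prob, ih] using h

lemma prob_eq_of_queries_eq_zero (X X' : Matrix Q Q ℂ) (S : Set ℝ)
    (alg : ForwardAlgorithm Q W) :
    alg.queries = 0 → ∀ ψ : Q × W → ℂ, alg.prob X S ψ = alg.prob X' S ψ := by
  induction alg with
  | output r => exact fun _ _ => rfl
  | measure k K hK next ih =>
    intro h ψ
    refine Finset.sum_congr rfl fun i hi => ih i (Nat.le_zero.mp ?_) _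
    exact (Finset.le_sup (f := fun i => (next i).queries) hi).trans h.le
  | query next ih => exact fun h => absurd h (Nat.succ_ne_zero _)

/-! ### Averaging over phases -/

variable {ι : Type} [Fintype ι] {N : ℕ}

/-- `alg.recordWeight A S φ n` is the squared norm of the part with record `n` of the final states
with output in `S`, when the algorithm queries `∑ i, z i • A i` with formal phases `z i`. A state
is a family `φ` of vectors, `φ n` being the coefficient of the monomial `∏ i, z i ^ n i`, and a
query sends the monomial `n` to the monomials `n + eᵢ`. Exponents are taken modulo `N`, since the
phases will be `N`-th roots of unity. -/
noncomputable def recordWeight [DecidableEq ι] (A : ι → Matrix Q Q ℂ) (S : Set ℝ) :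
    ForwardAlgorithm Q W → ((ι → ZMod N) → Q × W → ℂ) → (ι → ZMod N) → ℝ
  | output r, φ, n => S.indicator (fun _ => ∑ x, ‖φ n x‖ ^ 2) r
  | measure _ K _ next, φ, n => ∑ i, (next i).recordWeight A S (fun n' => K i *ᵥ φ n') n
  | query next, φ, n => next.recordWeight A S
      (fun n' => ∑ i, (A i ⊗ₖ (1 : Matrix W W ℂ)) *ᵥ φ (n' - Pi.single i 1)) n

lemma recordWeight_nonneg [DecidableEq ι] (A : ι → Matrix Q Q ℂ) (S : Set ℝ)
    (alg : ForwardAlgorithm Q W) :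
    ∀ (φ : (ι → ZMod N) → Q × W → ℂ) n, 0 ≤ alg.recordWeight A S φ n := by
  induction alg with
  | output r =>
    intro φ n
    exact Set.indicator_nonneg (fun _ _ => Finset.sum_nonneg fun _ _ => by positivity) _
  | measure k K hK next ih => exact fun φ n => Finset.sum_nonneg fun i _ => ih i _ _
  | query next ih => exact fun φ n => ih _ _

lemma recordWeight_le_univ [DecidableEq ι] (A : ι → Matrix Q Q ℂ) (S : Set ℝ)
    (alg : ForwardAlgorithm Q W) :
    ∀ (φ : (ι → ZMod N) → Q × W → ℂ) n,
      alg.recordWeight A S φ n ≤ alg.recordWeight A Set.univ φ n := by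
  induction alg with
  | output r =>
    intro φ n
    exact Set.indicator_le_indicator_of_subset (Set.subset_univ _)
      (fun _ => Finset.sum_nonneg fun _ _ => by positivity) _
  | measure k K hK next ih => exact fun φ n => Finset.sum_le_sum fun i _ => ih i _ _
  | query next ih => exact fun φ n => ih _ _

/-- The value of the monomial with exponents `n` at the roots of unity with exponents `j`. -/
noncomputable def monomialChar [NeZero N] (j n : ι → ZMod N) : ℂ :=
  ZMod.stdAddChar (∑ i, j i * n i)

lemma monomialChar_add_right [NeZero N] (j n n' : ι → ZMod N) :
    monomialChar j (n + n') = monomialChar j n * monomialChar j n' := by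
  simp [monomialChar, mul_add, Finset.sum_add_distrib, AddChar.map_add_eq_mul]

lemma monomialChar_single [NeZero N] [DecidableEq ι] (j : ι → ZMod N) (i : ι) :
    monomialChar j (Pi.single i 1) = ZMod.stdAddChar (j i) := by
  simp [monomialChar, Pi.single_apply]

lemma conj_monomialChar [NeZero N] (j n : ι → ZMod N) :
    (starRingEnd ℂ) (monomialChar j n) = monomialChar j (-n) := by
  simp [monomialChar, AddChar.map_neg_eq_conj]

lemma sum_monomialChar [NeZero N] [DecidableEq ι] (n : ι → ZMod N) :
    ∑ j, monomialChar j n = if n = 0 then (Fintype.card (ι → ZMod N) : ℂ) else 0 := by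
  have hadd : ∀ j j' : ι → ZMod N,
      monomialChar (j + j') n = monomialChar j n * monomialChar j' n := by
    intro j j'
    simp [monomialChar, add_mul, Finset.sum_add_distrib, AddChar.map_add_eq_mul]
  let χ : AddChar (ι → ZMod N) ℂ :=
    { toFun := fun j => monomialChar j n
      map_zero_eq_one' := by simp [monomialChar]
      map_add_eq_mul' := hadd }
  have h := AddChar.sum_eq_ite χ
  have hχ : χ = 0 ↔ n = 0 := by
    constructor
    · intro h0
      funext i
      have h1 : monomialChar (Pi.single i 1) n = 1 := DFunLike.congr_fun h0 (Pi.single i 1)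
      have h2 : ZMod.stdAddChar (n i) = (1 : ℂ) := by
        simpa [monomialChar, Pi.single_apply] using h1
      rw [← AddChar.map_zero_eq_one (ZMod.stdAddChar (N := N))] at h2
      exact ZMod.injective_stdAddChar h2
    · rintro rfl
      ext j
      simp [χ, monomialChar]
  simp only [hχ] at h
  exact h

/-- Parseval's identity for polynomials evaluated at all tuples of `N`-th roots of unity. -/
lemma sum_norm_sq_sum_monomialChar [NeZero N] [DecidableEq ι] (c : (ι → ZMod N) → ℂ) :
    ∑ j, ‖∑ n, monomialChar j n * c n‖ ^ 2
      = (Fintype.card (ι → ZMod N) : ℝ) * ∑ n, ‖c n‖ ^ 2 := by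
  apply Complex.ofReal_injective
  push_cast
  simp only [← Complex.mul_conj', map_sum, map_mul, conj_monomialChar, Finset.sum_mul_sum]
  rw [Finset.sum_comm, Finset.mul_sum]
  refine Finset.sum_congr rfl fun n _ => ?_
  rw [Finset.sum_comm]
  calc ∑ n', ∑ j, monomialChar j n * c n * (monomialChar j (-n') * (starRingEnd ℂ) (c n'))
      = ∑ n', (∑ j, monomialChar j (n - n')) * (c n * (starRingEnd ℂ) (c n')) := by
        refine Finset.sum_congr rfl fun n' _ => ?_
        rw [Finset.sum_mul]
        refine Finset.sum_congr rfl fun j _ => ?_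
        rw [sub_eq_add_neg, monomialChar_add_right]
        ring
    _ = _ := by
        simp only [sum_monomialChar, sub_eq_zero]
        simp [ite_mul]

/-- Averaging over the phases decoheres the records: the average probability of an output in `S`
is the sum of the weights of the records. -/
lemma sum_prob_eq_sum_recordWeight [NeZero N] [DecidableEq ι] (A : ι → Matrix Q Q ℂ) (S : Set ℝ)
    (alg : ForwardAlgorithm Q W) :
    ∀ φ : (ι → ZMod N) → Q × W → ℂ,
      ∑ j : ι → ZMod N, alg.prob (∑ i, (ZMod.stdAddChar (j i) : ℂ) • A i) S
          (∑ n, monomialChar j n • φ n)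
        = (Fintype.card (ι → ZMod N) : ℝ) * ∑ n, alg.recordWeight A S φ n := by
  induction alg with
  | output r =>
    intro φ
    by_cases hr : r ∈ S
    · simp only [prob, recordWeight, Set.indicator_of_mem hr, Finset.sum_apply, Pi.smul_apply,
        smul_eq_mul]
      rw [Finset.sum_comm]
      simp only [sum_norm_sq_sum_monomialChar]
      rw [← Finset.mul_sum, Finset.sum_comm]
    · simp [prob, recordWeight, Set.indicator_of_notMem hr]
  | measure k K hK next ih =>
    intro φ
    simp only [prob, recordWeight]
    rw [Finset.sum_comm, Finset.sum_comm (s := Finset.univ (α := ι → ZMod N)), Finset.mul_sum]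
    refine Finset.sum_congr rfl fun i _ => ?_
    rw [← ih i]
    simp only [Matrix.mulVec_sum, Matrix.mulVec_smul]
  | query next ih =>
    intro φ
    simp only [prob, recordWeight]
    rw [← ih]
    refine Finset.sum_congr rfl fun j _ => ?_
    congr 1
    simp only [Finset.smul_sum]
    rw [Finset.sum_comm]
    have hk : (∑ i, (ZMod.stdAddChar (j i) : ℂ) • A i) ⊗ₖ (1 : Matrix W W ℂ)
        = ∑ i, (ZMod.stdAddChar (j i) : ℂ) • (A i ⊗ₖ (1 : Matrix W W ℂ)) := by
      ext p q
      simp [Matrix.sum_apply, Finset.sum_mul, mul_assoc]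
    rw [hk, Matrix.sum_mulVec]
    refine Finset.sum_congr rfl fun i _ => ?_
    conv_rhs => rw [← Equiv.sum_comp (Equiv.addRight (Pi.single i (1 : ZMod N)))]
    simp only [Equiv.coe_addRight, add_sub_cancel_right, monomialChar_add_right,
      monomialChar_single, Matrix.mulVec_sum, Matrix.smul_mulVec, Matrix.mulVec_smul,
      smul_smul]

/-- The degree of the monomial with exponents `n`. -/
def recordDegree (n : ι → ZMod N) : ℕ := ∑ i, (n i).val

lemma card_support_le_recordDegree (n : ι → ZMod N) :
    (Finset.univ.filter fun i => n i ≠ 0).card ≤ recordDegree n := by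
  rw [Finset.card_filter]
  refine Finset.sum_le_sum fun i _ => ?_
  split_ifs with h
  · exact Nat.one_le_iff_ne_zero.mpr ((ZMod.val_ne_zero _).mpr h)
  · exact Nat.zero_le _

lemma recordDegree_le_sub_single [DecidableEq ι] (hN : 1 < N) (n : ι → ZMod N) (i : ι) :
    recordDegree n ≤ recordDegree (n - Pi.single i 1) + 1 := by
  have : Fact (1 < N) := ⟨hN⟩
  have h1 : ∑ l, (if l = i then 1 else 0) = 1 := by simp
  unfold recordDegree
  rw [← h1, ← Finset.sum_add_distrib]
  refine Finset.sum_le_sum fun l _ => ?_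
  by_cases hl : l = i
  · subst hl
    have := ZMod.val_add_le ((n - Pi.single l 1 : ι → ZMod N) l) 1
    simpa [ZMod.val_one] using this
  · simp [hl]

lemma recordWeight_eq_zero [DecidableEq ι] (hN : 1 < N) (A : ι → Matrix Q Q ℂ) (S : Set ℝ)
    (alg : ForwardAlgorithm Q W) :
    ∀ (k : ℕ) (φ : (ι → ZMod N) → Q × W → ℂ), (∀ n, k < recordDegree n → φ n = 0) →
      ∀ n, k + alg.queries < recordDegree n → alg.recordWeight A S φ n = 0 := by
  induction alg with
  | output r =>
    intro k φ hφ n hn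
    simp [recordWeight, hφ n hn]
  | measure l K hK next ih =>
    intro k φ hφ n hn
    refine Finset.sum_eq_zero fun i hi => ih i k _ (fun n' hn' => by simp [hφ n' hn']) n ?_
    have := Finset.le_sup (f := fun i => (next i).queries) hi
    simp only [queries] at this hn
    omega
  | query next ih =>
    intro k φ hφ n hn
    simp only [queries] at hn
    refine ih (k + 1) _ (fun n' hn' => Finset.sum_eq_zero fun i _ => ?_) n (by omega)
    have := recordDegree_le_sub_single hN n' i
    rw [hφ _ (by omega), Matrix.mulVec_zero]

/-- As long as exponents do not wrap around modulo `N`, the weight of a record depends only on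
those terms of the queried matrix that occur in the record. -/
lemma recordWeight_congr [NeZero N] [DecidableEq ι] (A A' : ι → Matrix Q Q ℂ) (S : Set ℝ)
    (alg : ForwardAlgorithm Q W) :
    ∀ (k : ℕ) (φ φ' : (ι → ZMod N) → Q × W → ℂ), k + alg.queries < N →
      (∀ n, k < recordDegree n → φ n = 0 ∧ φ' n = 0) →
      (∀ n : ι → ZMod N, (∀ i, n i ≠ 0 → A i = A' i) → φ n = φ' n) →
      ∀ n : ι → ZMod N, (∀ i, n i ≠ 0 → A i = A' i) →
        alg.recordWeight A S φ n = alg.recordWeight A' S φ' n := by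
  induction alg with
  | output r =>
    intro k φ φ' _ _ h n hn
    simp only [recordWeight, h n hn]
  | measure l K hK next ih =>
    intro k φ φ' hk h0 h n hn
    refine Finset.sum_congr rfl fun i hi => ih i k _ _ ?_ (fun n' hn' => ?_) (fun n' hn' => ?_) n hn
    · have := Finset.le_sup (f := fun i => (next i).queries) hi
      simp only [queries] at this hk
      omega
    · simp [h0 n' hn']
    · rw [h n' hn']
  | query next ih =>
    intro k φ φ' hk h0 h n hn
    simp only [queries] at hk
    have hN : 1 < N := by omega
    have : Fact (1 < N) := ⟨hN⟩
    refine ih (k + 1) _ _ (by omega) (fun n' hn' => ?_) (fun n' hn' => ?_) n hn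
    · have hd := fun i => recordDegree_le_sub_single hN n' i
      constructor <;> refine Finset.sum_eq_zero fun i _ => ?_
      · rw [(h0 (n' - Pi.single i 1) (by grind)).1, Matrix.mulVec_zero]
      · rw [(h0 (n' - Pi.single i 1) (by grind)).2, Matrix.mulVec_zero]
    · refine Finset.sum_congr rfl fun i _ => ?_
      rcases lt_or_ge k (recordDegree (n' - Pi.single i 1)) with hd | hd
      · rw [(h0 _ hd).1, (h0 _ hd).2, Matrix.mulVec_zero, Matrix.mulVec_zero]
      · have hi : n' i ≠ 0 := by
          intro hi
          have h1 : ((n' - Pi.single i 1 : ι → ZMod N) i).val ≤ k :=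
            (Finset.single_le_sum (f := fun l => ((n' - Pi.single i 1 : ι → ZMod N) l).val)
              (fun _ _ => Nat.zero_le _) (Finset.mem_univ i)).trans hd
          have h2 := ZMod.val_add_of_lt (a := (n' - Pi.single i 1 : ι → ZMod N) i) (b := 1)
            (by rw [ZMod.val_one]; omega)
          simp [hi, ZMod.val_one] at h2
        rw [hn' i hi, h (n' - Pi.single i 1) fun l hl => hn' l ?_]
        by_cases hli : l = i
        · rwa [hli]
        · simpa [hli] using hl

end ForwardAlgorithm

/-! ### Biased signs -/

/-- The sign `(-1) ^ x` of a bit. -/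
def bitSign (x : Fin 2) : ℝ := if x = 0 then 1 else -1

lemma bitSign_sq (x : Fin 2) : bitSign x ^ 2 = 1 := by
  unfold bitSign; split_ifs <;> norm_num

lemma bitSign_add_one (x : Fin 2) : bitSign (x + 1) = -bitSign x := by
  fin_cases x <;> simp [bitSign]

/-- `∏ i ∈ R, (1 + b * (-1) ^ sᵢ)`: the likelihood ratio, on the coordinates in `R`, between
independent signs of mean `b` and uniform ones. -/
noncomputable def signDensity {ι : Type} (b : ℝ) (R : Finset ι) (s : ι → Fin 2) : ℝ :=
  ∏ i ∈ R, (1 + b * bitSign (s i))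

lemma signDensity_nonneg {ι : Type} {b : ℝ} (hb0 : 0 ≤ b) (hb1 : b ≤ 1) (R : Finset ι)
    (s : ι → Fin 2) : 0 ≤ signDensity b R s := by
  refine Finset.prod_nonneg fun i _ => ?_
  unfold bitSign
  split_ifs <;> linarith

/-- Squaring a density tilts the bias to `2 b / (1 + b²)`, up to the factor `(1 + b²) ^ #R`. -/
lemma signDensity_sq {ι : Type} (b : ℝ) (R : Finset ι) (s : ι → Fin 2) :
    signDensity b R s ^ 2 = (1 + b ^ 2) ^ R.card * signDensity (2 * b / (1 + b ^ 2)) R s := by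
  unfold signDensity
  rw [← Finset.prod_pow, ← Finset.prod_const, ← Finset.prod_mul_distrib]
  refine Finset.prod_congr rfl fun i _ => ?_
  have h : (1 + b ^ 2) ≠ 0 := by positivity
  have := bitSign_sq (s i)
  field_simp
  linear_combination b ^ 2 * this

lemma signDensity_congr {ι : Type} (b : ℝ) {R : Finset ι} {s s' : ι → Fin 2}
    (h : ∀ i ∈ R, s i = s' i) : signDensity b R s = signDensity b R s' :=
  Finset.prod_congr rfl fun i hi => by rw [h i hi]

section
variable {ι : Type} [Fintype ι] [DecidableEq ι]

lemma sum_mul_bitSign_eq_zero {g : (ι → Fin 2) → ℝ} (i : ι)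
    (hg : ∀ s x, g (Function.update s i x) = g s) : ∑ s, g s * bitSign (s i) = 0 := by
  have hinv : Function.Involutive fun s : ι → Fin 2 => Function.update s i (s i + 1) := by
    intro s
    have : s i + 1 + 1 = s i := by generalize s i = x; fin_cases x <;> rfl
    simp [this]
  have h := Equiv.sum_comp hinv.toPerm fun s => g s * bitSign (s i)
  simp only [Function.Involutive.coe_toPerm, Function.update_self, hg, bitSign_add_one,
    mul_neg, Finset.sum_neg_distrib] at h
  linarith

/-- Coordinates on which `f` does not depend may be integrated out. -/
lemma sum_mul_signDensity_eq (b : ℝ) (R : Finset ι) {f : (ι → Fin 2) → ℝ}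
    (hf : ∀ s s', (∀ i ∈ R, s i = s' i) → f s = f s') :
    ∑ s, f s * signDensity b Finset.univ s = ∑ s, f s * signDensity b R s := by
  have key : ∀ A : Finset ι, Disjoint R A →
      ∑ s, f s * signDensity b (R ∪ A) s = ∑ s, f s * signDensity b R s := by
    intro A
    induction A using Finset.induction_on with
    | empty => simp
    | insert i A hi ih =>
      intro hd
      rw [Finset.disjoint_insert_right] at hd
      have hiA : i ∉ R ∪ A := by simp [hd.1, hi]
      have h0 := sum_mul_bitSign_eq_zero (g := fun s => f s * signDensity b (R ∪ A) s) i
        (fun s x => by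
          have h1 : ∀ l ∈ R ∪ A, Function.update s i x l = s l := fun l hl =>
            Function.update_of_ne (ne_of_mem_of_not_mem hl hiA) _ _
          rw [signDensity_congr b h1, hf _ s fun l hl => h1 l (Finset.mem_union_left _ hl)])
      rw [← ih hd.2, ← add_zero (∑ s, f s * signDensity b (R ∪ A) s), ← mul_zero b, ← h0,
        Finset.mul_sum, ← Finset.sum_add_distrib]
      refine Finset.sum_congr rfl fun s _ => ?_
      rw [Finset.union_insert, signDensity, Finset.prod_insert hiA, ← signDensity]
      ring
  rw [← key (Finset.univ \ R) Finset.disjoint_sdiff,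
    Finset.union_sdiff_of_subset (Finset.subset_univ R)]

lemma sum_signDensity (b : ℝ) :
    ∑ s : ι → Fin 2, signDensity b Finset.univ s = 2 ^ Fintype.card ι := by
  have := sum_mul_signDensity_eq (ι := ι) b ∅ (f := fun _ => 1) (fun _ _ _ => rfl)
  simpa [signDensity] using this

lemma sum_mul_signDensity_mul_sub (b : ℝ) (i : ι) {g : (ι → Fin 2) → ℝ}
    (hg : ∀ s x, g (Function.update s i x) = g s) :
    ∑ s, g s * (bitSign (s i) - b) * signDensity b Finset.univ s = 0 := by
  have h0 := sum_mul_bitSign_eq_zero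
    (g := fun s => (1 - b ^ 2) * (g s * signDensity b (Finset.univ.erase i) s)) i
    (fun s x => by
      have h1 : ∀ l ∈ Finset.univ.erase i, Function.update s i x l = s l := fun l hl =>
        Function.update_of_ne (Finset.ne_of_mem_erase hl) _ _
      rw [signDensity_congr b h1, hg])
  rw [← h0]
  refine Finset.sum_congr rfl fun s _ => ?_
  rw [signDensity, ← Finset.mul_prod_erase _ _ (Finset.mem_univ i), ← signDensity]
  linear_combination b * (g s * signDensity b (Finset.univ.erase i) s) * bitSign_sq (s i)

/-- The variance of a sum of independent biased signs. -/
lemma sum_sq_mul_signDensity_le (b : ℝ) :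
    ∑ s : ι → Fin 2, (∑ i, (bitSign (s i) - b)) ^ 2 * signDensity b Finset.univ s
      ≤ Fintype.card ι * 2 ^ Fintype.card ι := by
  have hoff : ∀ i l : ι, l ≠ i → ∑ s : ι → Fin 2,
      (bitSign (s l) - b) * (bitSign (s i) - b) * signDensity b Finset.univ s = 0 :=
    fun i l hl => sum_mul_signDensity_mul_sub b i (g := fun s => bitSign (s l) - b)
      (fun s x => by simp [hl])
  have hdiag : ∀ i : ι, ∑ s : ι → Fin 2,
      (bitSign (s i) - b) * (bitSign (s i) - b) * signDensity b Finset.univ s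
        = (1 - b ^ 2) * 2 ^ Fintype.card ι := by
    intro i
    have h0 := sum_mul_signDensity_mul_sub b i (g := fun _ : ι → Fin 2 => 2 * b) (fun _ _ => rfl)
    rw [← sum_signDensity b, ← add_zero (∑ s : ι → Fin 2, _ * _), ← h0, Finset.mul_sum,
      ← Finset.sum_add_distrib]
    refine Finset.sum_congr rfl fun s _ => ?_
    linear_combination signDensity b Finset.univ s * bitSign_sq (s i)
  calc ∑ s : ι → Fin 2, (∑ i, (bitSign (s i) - b)) ^ 2 * signDensity b Finset.univ s
      = ∑ i, ∑ l, ∑ s : ι → Fin 2,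
          (bitSign (s l) - b) * (bitSign (s i) - b) * signDensity b Finset.univ s := by
        simp only [Finset.sum_comm (t := Finset.univ (α := ι → Fin 2))]
        refine Finset.sum_congr rfl fun s _ => ?_
        rw [sq, Finset.sum_mul_sum, Finset.sum_comm, Finset.sum_mul]
        simp only [Finset.sum_mul]
    _ = ∑ _i : ι, (1 - b ^ 2) * 2 ^ Fintype.card ι := by
        refine Finset.sum_congr rfl fun i _ => ?_
        rw [Finset.sum_eq_single i (fun l _ hl => hoff i l hl) (by simp), hdiag]
    _ ≤ Fintype.card ι * 2 ^ Fintype.card ι := by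
        rw [Finset.sum_const, Finset.card_univ, nsmul_eq_mul]
        gcongr
        have : (0 : ℝ) < 2 ^ Fintype.card ι := by positivity
        nlinarith [sq_nonneg b]

/-- Chebyshev's inequality for independent biased signs. -/
lemma sum_signDensity_deviation_le {b : ℝ} (hb0 : 0 ≤ b) (hb1 : b ≤ 1) {t : ℝ} (ht : 0 < t) :
    ∑ s : ι → Fin 2 with t ≤ |∑ i, (bitSign (s i) - b)|, signDensity b Finset.univ s
      ≤ Fintype.card ι / t ^ 2 * 2 ^ Fintype.card ι := by
  rw [div_mul_eq_mul_div, le_div_iff₀ (by positivity), Finset.sum_mul]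
  refine le_trans ?_ (sum_sq_mul_signDensity_le b)
  refine (Finset.sum_le_sum fun s hs => ?_).trans
    (Finset.sum_le_sum_of_subset_of_nonneg (Finset.filter_subset _ _) fun s _ _ =>
      mul_nonneg (sq_nonneg _) (signDensity_nonneg hb0 hb1 _ s))
  rw [Finset.mem_filter] at hs
  rw [mul_comm, ← sq_abs (∑ i, _)]
  gcongr
  · exact signDensity_nonneg hb0 hb1 _ s
  · exact hs.2

end

/-! ### The hard unitaries -/

lemma exists_unitary_flat_column (m : ℕ) [NeZero m] :
    ∃ F ∈ Matrix.unitaryGroup (Fin m) ℂ, ∀ i, ‖F i 0‖ ^ 2 = 1 / (m : ℝ) := by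
  have hm : (0 : ℝ) < m := by exact_mod_cast Nat.pos_of_ne_zero (NeZero.ne m)
  let u : EuclideanSpace ℂ (Fin m) := WithLp.toLp 2 fun _ => ((Real.sqrt m)⁻¹ : ℝ)
  have hu : ‖u‖ = 1 := by
    rw [EuclideanSpace.norm_eq, Real.sqrt_eq_one]
    simp [u, hm.ne']
  have ho : Orthonormal ℂ (Set.domRestrict {(0 : Fin m)} fun _ => u) := by
    constructor
    · intro; exact hu
    · intro i j hij; exact absurd (Subsingleton.elim i j) hij
  obtain ⟨B, hB⟩ := ho.exists_orthonormalBasis_extension_of_card_eq (by simp)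
  refine ⟨(EuclideanSpace.basisFun (Fin m) ℂ).toBasis.toMatrix B,
    OrthonormalBasis.toMatrix_orthonormalBasis_mem_unitary _ _, fun i => ?_⟩
  have : (EuclideanSpace.basisFun (Fin m) ℂ).toBasis.toMatrix B i 0 = u i := by
    rw [Module.Basis.toMatrix_apply, hB 0 rfl]
    simp
  rw [this]
  simp [u]

/-- The operator `|i⟩⟨i| F ⊗ NOT ^ x` on `ℂ^m ⊗ ℂ^2`. -/
def flaggedRow {m : ℕ} (F : Matrix (Fin m) (Fin m) ℂ) (i : Fin m) (x : Fin 2) :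
    Matrix (Fin m × Fin 2) (Fin m × Fin 2) ℂ :=
  Matrix.of fun p q => if p.1 = i ∧ p.2 = q.2 + x then F i q.1 else 0

lemma sum_smul_flaggedRow_apply {m : ℕ} (F : Matrix (Fin m) (Fin m) ℂ) (z : Fin m → ℂ)
    (s : Fin m → Fin 2) (p q : Fin m × Fin 2) :
    (∑ i, z i • flaggedRow F i (s i)) p q
      = if p.2 = q.2 + s p.1 then z p.1 * F p.1 q.1 else 0 := by
  rw [Matrix.sum_apply, Finset.sum_eq_single p.1]
  · simp [flaggedRow]
  · intro i _ hi
    simp [flaggedRow, hi.symm]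
  · simp

lemma sum_smul_flaggedRow_mem_unitaryGroup {m : ℕ} {F : Matrix (Fin m) (Fin m) ℂ}
    (hF : F ∈ Matrix.unitaryGroup (Fin m) ℂ) {z : Fin m → ℂ} (hz : ∀ i, ‖z i‖ = 1)
    (s : Fin m → Fin 2) :
    ∑ i, z i • flaggedRow F i (s i) ∈ Matrix.unitaryGroup (Fin m × Fin 2) ℂ := by
  rw [Matrix.mem_unitaryGroup_iff] at hF ⊢
  ext p p'
  have hFp : ∑ k, F p.1 k * star (F p'.1 k) = if p.1 = p'.1 then 1 else 0 := by
    have := congrFun (congrFun hF p.1) p'.1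
    simpa [Matrix.mul_apply, Matrix.one_apply] using this
  calc (_ * star _ : Matrix (Fin m × Fin 2) (Fin m × Fin 2) ℂ) p p'
      = ∑ k, ∑ c : Fin 2, (if p.2 = c + s p.1 then z p.1 * F p.1 k else 0)
          * star (if p'.2 = c + s p'.1 then z p'.1 * F p'.1 k else 0) := by
        rw [Matrix.mul_apply, Fintype.sum_prod_type]
        simp only [Matrix.star_apply, sum_smul_flaggedRow_apply]
    _ = (∑ c : Fin 2, if p.2 = c + s p.1 ∧ p'.2 = c + s p'.1 then 1 else 0)
          * (z p.1 * star (z p'.1) * ∑ k, F p.1 k * star (F p'.1 k)) := by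
        rw [Finset.sum_comm, Finset.sum_mul]
        refine Finset.sum_congr rfl fun c _ => ?_
        by_cases h1 : p.2 = c + s p.1 <;> by_cases h2 : p'.2 = c + s p'.1
        · simp only [h1, h2, and_self, if_true, one_mul, Finset.mul_sum, star_mul']
          refine Finset.sum_congr rfl fun k _ => ?_
          ring
        all_goals simp [h1, h2]
    _ = (1 : Matrix (Fin m × Fin 2) (Fin m × Fin 2) ℂ) p p' := by
        rw [hFp]
        obtain ⟨i, x⟩ := p
        obtain ⟨i', x'⟩ := p'
        by_cases hi : i = i'
        · subst hi
          have hzz : z i * star (z i) = 1 := by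
            have := Complex.mul_conj' (z i)
            rw [hz i] at this
            simpa using this
          have hc : (∑ c : Fin 2, if x = c + s i ∧ x' = c + s i then (1 : ℂ) else 0)
              = if x = x' then 1 else 0 := by
            generalize s i = y
            fin_cases x <;> fin_cases x' <;> fin_cases y <;> simp <;> decide
          simp only [if_true, mul_one, hzz, hc]
          simp [Matrix.one_apply]
        · simp [hi]

lemma exists_norm_eq_one_smul {E : Type*} [NormedAddCommGroup E] [NormedSpace ℂ E] [Nontrivial E]
    (v : E) : ∃ u : E, ‖u‖ = 1 ∧ v = (‖v‖ : ℂ) • u := by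
  by_cases hv : v = 0
  · obtain ⟨u, hu⟩ := exists_norm_eq E zero_le_one
    exact ⟨u, hu, by simp [hv]⟩
  · have h : (‖v‖ : ℂ) ≠ 0 := by exact_mod_cast norm_ne_zero_iff.mpr hv
    exact ⟨(‖v‖ : ℂ)⁻¹ • v, by simp [norm_smul, hv], by rw [smul_smul, mul_inv_cancel₀ h, one_smul]⟩

lemma hasAmplitude_of_sum_norm_sq {m : ℕ} [NeZero m]
    {X : Matrix (Fin m × Fin 2) (Fin m × Fin 2) ℂ} {a : ℝ} (ha0 : 0 ≤ a) (ha1 : a ≤ 1)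
    (h0 : ∑ i, ‖(X *ᵥ ketZero m) (i, 0)‖ ^ 2 = a ^ 2)
    (h1 : ∑ i, ‖(X *ᵥ ketZero m) (i, 1)‖ ^ 2 = 1 - a ^ 2) : HasAmplitude X a := by
  let v : Fin 2 → EuclideanSpace ℂ (Fin m) :=
    fun x => WithLp.toLp 2 fun i => (X *ᵥ ketZero m) (i, x)
  have hv0 : ‖v 0‖ = a := by
    rw [EuclideanSpace.norm_eq]
    simp only [v, h0, Real.sqrt_sq ha0]
  have hv1 : ‖v 1‖ = Real.sqrt (1 - a ^ 2) := by
    rw [EuclideanSpace.norm_eq]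
    simp only [v, h1]
  obtain ⟨u, hu, hvu⟩ := exists_norm_eq_one_smul (v 0)
  obtain ⟨u', hu', hvu'⟩ := exists_norm_eq_one_smul (v 1)
  refine ⟨ha0, ha1, u, u', hu, hu', fun i => ⟨?_, ?_⟩⟩
  · have := congrArg (fun w : EuclideanSpace ℂ (Fin m) => w i) hvu
    simpa [v, hv0] using this
  · have := congrArg (fun w : EuclideanSpace ℂ (Fin m) => w i) hvu'
    simpa [v, hv1] using this

/-- The amplitude belonging to a sign pattern: its square is the fraction of signs `+1`. -/
noncomputable def signAmplitude {m : ℕ} (s : Fin m → Fin 2) : ℝ :=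
  Real.sqrt ((1 + (∑ i, bitSign (s i)) / m) / 2)

lemma hasAmplitude_sum_smul_flaggedRow {m : ℕ} [NeZero m] {F : Matrix (Fin m) (Fin m) ℂ}
    (hF : ∀ i, ‖F i 0‖ ^ 2 = 1 / (m : ℝ)) {z : Fin m → ℂ} (hz : ∀ i, ‖z i‖ = 1)
    (s : Fin m → Fin 2) :
    HasAmplitude (∑ i, z i • flaggedRow F i (s i)) (signAmplitude s) := by
  have hm : (m : ℝ) ≠ 0 := by exact_mod_cast NeZero.ne m
  have hent : ∀ i x, ‖((∑ i, z i • flaggedRow F i (s i)) *ᵥ ketZero m) (i, x)‖ ^ 2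
      = if x = s i then 1 / (m : ℝ) else 0 := by
    intro i x
    have h : ((∑ i, z i • flaggedRow F i (s i)) *ᵥ ketZero m) (i, x)
        = if x = s i then z i * F i 0 else 0 := by
      rw [ketZero, Matrix.mulVec_single_one, Matrix.col_apply, sum_smul_flaggedRow_apply, zero_add]
    rw [h]
    split_ifs
    · rw [norm_mul, hz, one_mul, hF]
    · simp
  have hsum : ∀ x : Fin 2, ∑ i, ‖((∑ i, z i • flaggedRow F i (s i)) *ᵥ ketZero m) (i, x)‖ ^ 2
      = (1 + bitSign x * ((∑ i, bitSign (s i)) / m)) / 2 := by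
    intro x
    have h : ∀ i, (if x = s i then 1 / (m : ℝ) else 0)
        = 1 / (2 * m) + bitSign x / (2 * m) * bitSign (s i) := by
      intro i
      generalize s i = y
      fin_cases x <;> fin_cases y <;> simp [bitSign] <;> field_simp <;> norm_num
    simp only [hent, h, Finset.sum_add_distrib, ← Finset.mul_sum]
    simp only [Finset.sum_const, Finset.card_univ, Fintype.card_fin, nsmul_eq_mul]
    field_simp
  have h0 := hsum 0
  have h1 := hsum 1
  simp only [bitSign, if_true, one_mul, one_ne_zero, if_false] at h0 h1
  have hnn : 0 ≤ (1 + (∑ i, bitSign (s i)) / m) / 2 := by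
    unfold bitSign; rw [← h0]; positivity
  have hnn1 : 0 ≤ (1 - (∑ i, bitSign (s i)) / m) / 2 := by
    have : 0 ≤ (1 + -1 * ((∑ i, bitSign (s i)) / m)) / 2 := by
      unfold bitSign; rw [← h1]; positivity
    linarith
  have hsq : signAmplitude s ^ 2 = (1 + (∑ i, bitSign (s i)) / m) / 2 := Real.sq_sqrt hnn
  refine hasAmplitude_of_sum_norm_sq (Real.sqrt_nonneg _) ?_ ?_ ?_
  · exact Real.sqrt_le_one.mpr (by linarith)
  · rw [hsq, h0]; rfl
  · rw [hsq, h1]; unfold bitSign; ring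

/-! ### Indistinguishability of nearby biases -/

/-- A `χ²` bound for adaptive observation of random signs. Outcome `n` has probability `wU s n`,
which depends only on the at most `T` signs in `R n`; `w` is the part of it that is accepted.
Changing the bias of the signs from `0` to `b` changes the acceptance probability by at most
`√((1 + b²) ^ T - 1)`. -/
lemma sq_sum_mul_signDensity_sub_le {ι κ : Type} [Fintype ι] [DecidableEq ι] [Fintype κ]
    {w wU : (ι → Fin 2) → κ → ℝ} (R : κ → Finset ι) (T : ℕ)
    (h0 : ∀ s n, 0 ≤ w s n) (hle : ∀ s n, w s n ≤ wU s n) (hU : ∀ s, ∑ n, wU s n = 1)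
    (hw : ∀ n s s', (∀ i ∈ R n, s i = s' i) → w s n = w s' n)
    (hwU : ∀ n s s', (∀ i ∈ R n, s i = s' i) → wU s n = wU s' n)
    (hT : ∀ s n, T < (R n).card → wU s n = 0) {b : ℝ} (hb0 : 0 ≤ b) :
    (∑ s, (∑ n, w s n) * signDensity b Finset.univ s - ∑ s, ∑ n, w s n) ^ 2
      ≤ (2 ^ Fintype.card ι) ^ 2 * ((1 + b ^ 2) ^ T - 1) := by
  -- The bias of the signs outside `R n` does not matter for outcome `n`.
  have hmarg : ∀ (v : (ι → Fin 2) → κ → ℝ) (b' : ℝ),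
      (∀ n s s', (∀ i ∈ R n, s i = s' i) → v s n = v s' n) →
      ∑ s, (∑ n, v s n) * signDensity b' Finset.univ s
        = ∑ s, ∑ n, v s n * signDensity b' (R n) s := by
    intro v b' hv
    simp only [Finset.sum_mul]
    rw [Finset.sum_comm, Finset.sum_comm (s := Finset.univ (α := ι → Fin 2))]
    exact Finset.sum_congr rfl fun n _ => sum_mul_signDensity_eq b' (R n) (hv n)
  have hone : ∀ b' : ℝ, ∑ s, ∑ n, wU s n * signDensity b' (R n) s = 2 ^ Fintype.card ι := by
    intro b'
    rw [← hmarg wU b' hwU, ← sum_signDensity b']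
    simp [hU]
  have hU0 : ∀ s n, 0 ≤ wU s n := fun s n => (h0 s n).trans (hle s n)
  have hdiff : ∑ s, (∑ n, w s n) * signDensity b Finset.univ s - ∑ s, ∑ n, w s n
      = ∑ p : (ι → Fin 2) × κ, w p.1 p.2 * (signDensity b (R p.2) p.1 - 1) := by
    rw [hmarg w b hw, Fintype.sum_prod_type]
    simp only [mul_sub, mul_one, Finset.sum_sub_distrib]
  have hsum : ∑ p : (ι → Fin 2) × κ, wU p.1 p.2 = 2 ^ Fintype.card ι := by
    rw [Fintype.sum_prod_type]
    simp [hU]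
  -- The squared density is a multiple of the density of another bias, for which the outcome
  -- probabilities still add up to one.
  have hsq : ∑ p : (ι → Fin 2) × κ, wU p.1 p.2 * signDensity b (R p.2) p.1 ^ 2
      ≤ (1 + b ^ 2) ^ T * 2 ^ Fintype.card ι := by
    rw [← hone (2 * b / (1 + b ^ 2)), ← Fintype.sum_prod_type', Finset.mul_sum]
    refine Finset.sum_le_sum fun p _ => ?_
    rcases lt_or_ge T (R p.2).card with hp | hp
    · simp [hT _ _ hp]
    · have hb' : 2 * b / (1 + b ^ 2) ≤ 1 := by
        rw [div_le_one (by positivity)]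
        nlinarith [sq_nonneg (b - 1)]
      have hpow : (1 + b ^ 2) ^ (R p.2).card ≤ (1 + b ^ 2) ^ T :=
        pow_le_pow_right₀ (by nlinarith [sq_nonneg b]) hp
      rw [signDensity_sq, mul_left_comm]
      exact mul_le_mul_of_nonneg_right hpow
        (mul_nonneg (hU0 _ _) (signDensity_nonneg (by positivity) hb' _ _))
  have hvar : ∑ p : (ι → Fin 2) × κ, wU p.1 p.2 * (signDensity b (R p.2) p.1 - 1) ^ 2
      ≤ 2 ^ Fintype.card ι * ((1 + b ^ 2) ^ T - 1) := by
    have hlin := hone b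
    rw [← Fintype.sum_prod_type'] at hlin
    have : ∑ p : (ι → Fin 2) × κ, wU p.1 p.2 * (signDensity b (R p.2) p.1 - 1) ^ 2
        = ∑ p : (ι → Fin 2) × κ, wU p.1 p.2 * signDensity b (R p.2) p.1 ^ 2
          - 2 * ∑ p : (ι → Fin 2) × κ, wU p.1 p.2 * signDensity b (R p.2) p.1
          + ∑ p : (ι → Fin 2) × κ, wU p.1 p.2 := by
      rw [Finset.mul_sum, ← Finset.sum_sub_distrib, ← Finset.sum_add_distrib]
      exact Finset.sum_congr rfl fun p _ => by ring
    rw [this, hlin, hsum]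
    linarith
  rw [hdiff]
  calc _ ≤ (∑ p : (ι → Fin 2) × κ, w p.1 p.2)
          * ∑ p : (ι → Fin 2) × κ, w p.1 p.2 * (signDensity b (R p.2) p.1 - 1) ^ 2 :=
        Finset.sum_sq_le_sum_mul_sum_of_sq_le_mul _ (fun p _ => h0 _ _)
          (fun p _ => mul_nonneg (h0 _ _) (sq_nonneg _)) (fun p _ => le_of_eq (by ring))
    _ ≤ (∑ p : (ι → Fin 2) × κ, wU p.1 p.2)
          * ∑ p : (ι → Fin 2) × κ, wU p.1 p.2 * (signDensity b (R p.2) p.1 - 1) ^ 2 := by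
        gcongr with p _ p _
        · exact Finset.sum_nonneg fun p _ => mul_nonneg (h0 _ _) (sq_nonneg _)
        · exact Finset.sum_nonneg fun p _ => hU0 _ _
        · exact hle _ _
        · exact hle _ _
    _ ≤ _ := by
        rw [hsum, sq, mul_assoc]
        gcongr

namespace ForwardAlgorithm

/-- An algorithm with `T` queries to `∑ i, z i • B i (s i)`, for uniformly random roots of unity
`z i`, cannot distinguish uniform signs `s` from signs of bias `b` unless `b² T` is large. Here
`p s` is its average acceptance probability on the sign pattern `s`. -/
lemma sq_sum_average_prob_sub_le {Q W ι : Type} [Fintype Q] [DecidableEq Q] [Fintype W]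
    [DecidableEq W] [Fintype ι] [DecidableEq ι] {N : ℕ} [NeZero N]
    (alg : ForwardAlgorithm Q W) (hN : alg.queries < N) (hN1 : 1 < N)
    (B : ι → Fin 2 → Matrix Q Q ℂ)
    (hB : ∀ (j : ι → ZMod N) (s : ι → Fin 2),
      ∑ i, (ZMod.stdAddChar (j i) : ℂ) • B i (s i) ∈ Matrix.unitaryGroup Q ℂ)
    (S : Set ℝ) {ψ : Q × W → ℂ} (hψ : ∑ x, ‖ψ x‖ ^ 2 = 1) {p : (ι → Fin 2) → ℝ}
    (hp : ∀ s, ∑ j : ι → ZMod N, alg.prob (∑ i, (ZMod.stdAddChar (j i) : ℂ) • B i (s i)) S ψ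
      = Fintype.card (ι → ZMod N) * p s) {b : ℝ} (hb0 : 0 ≤ b) :
    (∑ s, p s * signDensity b Finset.univ s - ∑ s, p s) ^ 2
      ≤ (2 ^ Fintype.card ι) ^ 2 * ((1 + b ^ 2) ^ alg.queries - 1) := by
  let φ : (ι → ZMod N) → Q × W → ℂ := Pi.single 0 ψ
  let w : Set ℝ → (ι → Fin 2) → (ι → ZMod N) → ℝ :=
    fun S s n => alg.recordWeight (fun i => B i (s i)) S φ n
  have hcard : (Fintype.card (ι → ZMod N) : ℝ) ≠ 0 := by exact_mod_cast Fintype.card_ne_zero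
  have hφ : ∀ j : ι → ZMod N, ∑ n, monomialChar j n • φ n = ψ := by
    intro j
    rw [Finset.sum_eq_single 0 (fun n _ hn => by simp [φ, hn]) (by simp)]
    simp [φ, monomialChar]
  have hφ0 : ∀ n, 0 < recordDegree n → φ n = 0 := by
    intro n hn
    have : n ≠ 0 := by rintro rfl; simp [recordDegree] at hn
    simp [φ, this]
  have hsum : ∀ S s, ∑ j : ι → ZMod N,
      alg.prob (∑ i, (ZMod.stdAddChar (j i) : ℂ) • B i (s i)) S ψ
        = Fintype.card (ι → ZMod N) * ∑ n, w S s n := by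
    intro S s
    have := sum_prob_eq_sum_recordWeight (fun i => B i (s i)) S alg φ
    simpa only [hφ] using this
  have hps : p = fun s => ∑ n, w S s n := by
    funext s
    exact mul_left_cancel₀ hcard ((hp s).symm.trans (hsum S s))
  have hdep : ∀ (S : Set ℝ) (n : ι → ZMod N) (s s' : ι → Fin 2),
      (∀ i ∈ Finset.univ.filter (fun i => n i ≠ 0), s i = s' i) → w S s n = w S s' n := by
    intro S n s s' h
    refine recordWeight_congr _ _ S alg 0 φ φ (by omega) (fun n hn => ⟨hφ0 n hn, hφ0 n hn⟩)
      (fun _ _ => rfl) n fun i hi => ?_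
    rw [h i (by simpa using hi)]
  rw [hps]
  refine sq_sum_mul_signDensity_sub_le (wU := w Set.univ)
    (fun n => Finset.univ.filter fun i => n i ≠ 0) alg.queries
    (fun s n => recordWeight_nonneg _ _ _ _ _) (fun s n => recordWeight_le_univ _ _ _ _ _)
    (fun s => ?_) (hdep S) (hdep Set.univ) (fun s n hn => ?_) hb0
  · have := hsum Set.univ s
    simp only [prob_univ (hB _ _), hψ, Finset.sum_const, Finset.card_univ, nsmul_eq_mul,
      mul_one] at this
    exact (mul_left_cancel₀ hcard (by rw [mul_one]; exact this)).symm
  · refine recordWeight_eq_zero hN1 _ _ alg 0 φ hφ0 n ?_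
    rw [zero_add]
    exact hn.trans_le (card_support_le_recordDegree n)

/-! ### The lower bound -/

variable {m w : ℕ} [NeZero m] [NeZero w]

lemma sum_norm_sq_single {α : Type*} [Fintype α] [DecidableEq α] (x : α) :
    ∑ y, ‖(Pi.single x 1 : α → ℂ) y‖ ^ 2 = 1 := by
  rw [Finset.sum_eq_single x (fun y _ hy => by simp [hy]) (by simp)]
  simp

lemma signAmplitude_const (m : ℕ) [NeZero m] (x : Fin 2) :
    signAmplitude (fun _ : Fin m => x) = Real.sqrt ((1 + bitSign x) / 2) := by
  have hm : (m : ℝ) ≠ 0 := by exact_mod_cast NeZero.ne m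
  simp [signAmplitude, hm]

/-- Without queries the output cannot be close to both amplitudes `0` and `1`. -/
lemma SolvesAmplitudeEstimation.one_le_queries {ε : ℝ} (hε : ε ≤ 1 / 2)
    {alg : ForwardAlgorithm (Fin m × Fin 2) (Fin w)} (h : alg.SolvesAmplitudeEstimation ε) :
    1 ≤ alg.queries := by
  by_contra hq
  obtain ⟨F, hF, hcol⟩ := exists_unitary_flat_column m
  let X : Fin 2 → Matrix (Fin m × Fin 2) (Fin m × Fin 2) ℂ :=
    fun x => ∑ i, (1 : ℂ) • flaggedRow F i x
  have hX : ∀ x, X x ∈ Matrix.unitaryGroup _ ℂ := fun x =>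
    sum_smul_flaggedRow_mem_unitaryGroup hF (z := fun _ => 1) (by simp) (fun _ => x)
  have hamp : ∀ x, HasAmplitude (X x) (Real.sqrt ((1 + bitSign x) / 2)) := fun x => by
    rw [← signAmplitude_const m]
    exact hasAmplitude_sum_smul_flaggedRow hcol (z := fun _ => 1) (by simp) (fun _ => x)
  have h1 := h _ (hX 0) _ (hamp 0)
  have h0 := h _ (hX 1) _ (hamp 1)
  rw [prob_eq_of_queries_eq_zero (X 1) (X 0) _ alg (by omega)] at h0
  have hd : Disjoint (Set.Ioo (Real.sqrt ((1 + bitSign 0) / 2) - ε)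
        (Real.sqrt ((1 + bitSign 0) / 2) + ε))
      (Set.Ioo (Real.sqrt ((1 + bitSign 1) / 2) - ε) (Real.sqrt ((1 + bitSign 1) / 2) + ε)) := by
    rw [Set.disjoint_left]
    rintro x ⟨hx, _⟩ ⟨_, hx'⟩
    norm_num [bitSign] at hx hx'
    linarith
  have hu := prob_mono (X 0) (Set.subset_univ _) alg (Pi.single ((0, 0), 0) 1)
    |>.trans' (prob_union_of_disjoint (X 0) hd alg (Pi.single ((0, 0), 0) 1)).ge
  rw [prob_univ (hX 0), sum_norm_sq_single] at hu
  linarith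

/-- The gap between typical amplitudes for unbiased signs and for signs of bias
`8 ε + 2 δ` is at least `2 ε`. -/
lemma sqrt_add_le_sqrt {ε δ : ℝ} (hε : 0 < ε) (hδ : 0 < δ) (h : 8 * ε + 2 * δ ≤ 1) :
    Real.sqrt ((1 + δ) / 2) + 2 * ε ≤ Real.sqrt ((1 + (8 * ε + δ)) / 2) := by
  have hx := Real.sq_sqrt (show 0 ≤ (1 + δ) / 2 by positivity)
  have hx0 := Real.sqrt_nonneg ((1 + δ) / 2)
  have hx1 : Real.sqrt ((1 + δ) / 2) ≤ 7 / 8 := Real.sqrt_le_iff.mpr ⟨by norm_num, by linarith⟩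
  apply Real.le_sqrt_of_sq_le
  nlinarith

/-- The sign sums deviate from their means by less than `4 √m` with probability at least `15/16`.
The bias `b` is chosen such that typical amplitudes for bias `0` and for bias `b` then differ by
`2 ε`, so the algorithm tells the two distributions apart. -/
lemma SolvesAmplitudeEstimation.quarter_le {ε : ℝ} (hε : 0 < ε)
    {alg : ForwardAlgorithm (Fin m × Fin 2) (Fin w)} (h : alg.SolvesAmplitudeEstimation ε)
    {b : ℝ} (hb : b = 8 * ε + 8 / Real.sqrt m) (hb1 : b ≤ 1) :
    1 / 4 ≤ b ^ 2 * alg.queries := by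
  have hm : (0 : ℝ) < m := by exact_mod_cast Nat.pos_of_ne_zero (NeZero.ne m)
  have hr : 0 < Real.sqrt m := Real.sqrt_pos.mpr hm
  have hrm : Real.sqrt m ^ 2 = m := Real.sq_sqrt hm.le
  obtain ⟨F, hF, hcol⟩ := exists_unitary_flat_column m
  set δ : ℝ := 4 / Real.sqrt m with hδ
  have hδ0 : 0 < δ := by positivity
  have hbδ : b = 8 * ε + 2 * δ := by rw [hb, hδ]; ring
  have hb0 : 0 ≤ b := by rw [hbδ]; positivity
  have hδm : 4 * Real.sqrt m / m = δ := by
    rw [hδ]; field_simp; rw [hrm]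
  -- More exponents than queries, so that exponents never wrap around.
  let N := alg.queries + 2
  -- Amplitude estimates that speak for bias `0`.
  let S : Set ℝ := Set.Iio (Real.sqrt ((1 + δ) / 2) + ε)
  let ψ : (Fin m × Fin 2) × Fin w → ℂ := Pi.single ((0, 0), 0) 1
  have hψ : ∑ x, ‖ψ x‖ ^ 2 = 1 := sum_norm_sq_single _
  let X : (Fin m → Fin 2) → (Fin m → ZMod N) → Matrix (Fin m × Fin 2) (Fin m × Fin 2) ℂ :=
    fun s j => ∑ i, (ZMod.stdAddChar (j i) : ℂ) • flaggedRow F i (s i)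
  have hX : ∀ s j, X s j ∈ Matrix.unitaryGroup _ ℂ := fun s j =>
    sum_smul_flaggedRow_mem_unitaryGroup hF (fun i => AddChar.norm_apply _ _) s
  have hsolve : ∀ s j, 99 / 100 ≤
      alg.prob (X s j) (Set.Ioo (signAmplitude s - ε) (signAmplitude s + ε)) ψ := fun s j =>
    h _ (hX s j) _ (hasAmplitude_sum_smul_flaggedRow hcol (fun i => AddChar.norm_apply _ _) s)
  have htot : ∀ s j, alg.prob (X s j) Set.univ ψ = 1 := fun s j => by
    rw [prob_univ (hX s j), hψ]
  have hcard : (0 : ℝ) < Fintype.card (Fin m → ZMod N) := by exact_mod_cast Fintype.card_pos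
  -- The probability of such an estimate, averaged over the phases.
  let p : (Fin m → Fin 2) → ℝ :=
    fun s => (∑ j, alg.prob (X s j) S ψ) / Fintype.card (Fin m → ZMod N)
  have hp_le : ∀ s (c : ℝ), (∀ j, alg.prob (X s j) S ψ ≤ c) → p s ≤ c := by
    intro s c hc
    rw [div_le_iff₀ hcard, mul_comm, ← nsmul_eq_mul, ← Finset.card_univ]
    exact Finset.sum_le_card_nsmul _ _ _ fun j _ => hc j
  have hp_ge : ∀ s (c : ℝ), (∀ j, c ≤ alg.prob (X s j) S ψ) → c ≤ p s := by
    intro s c hc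
    rw [le_div_iff₀ hcard, mul_comm, ← nsmul_eq_mul, ← Finset.card_univ]
    exact Finset.card_nsmul_le_sum _ _ _ fun j _ => hc j
  have hp0 : ∀ s, 0 ≤ p s := fun s => hp_ge s 0 fun j => prob_nonneg _ _ _ _
  have hp1 : ∀ s, p s ≤ 1 := fun s => hp_le s 1 fun j =>
    (prob_mono _ (Set.subset_univ _) _ _).trans (htot s j).le
  have hlow : ∀ s : Fin m → Fin 2, |∑ i, (bitSign (s i) - 0)| < 4 * Real.sqrt m →
      99 / 100 ≤ p s := by
    intro s hs
    refine hp_ge s _ fun j => (hsolve s j).trans (prob_mono _ (fun x hx => ?_) _ _)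
    have h1 : (∑ i, bitSign (s i)) / m ≤ δ := by
      rw [← hδm]
      gcongr
      simpa using (abs_lt.mp hs).2.le
    have h2 : signAmplitude s ≤ Real.sqrt ((1 + δ) / 2) := Real.sqrt_le_sqrt (by linarith)
    exact hx.2.trans_le (by linarith)
  have hhigh : ∀ s : Fin m → Fin 2, |∑ i, (bitSign (s i) - b)| < 4 * Real.sqrt m →
      p s ≤ 1 / 100 := by
    intro s hs
    refine hp_le s _ fun j => ?_
    have h1 : b - δ ≤ (∑ i, bitSign (s i)) / m := by
      have := (abs_lt.mp hs).1
      rw [Finset.sum_sub_distrib] at this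
      simp only [Finset.sum_const, Finset.card_univ, Fintype.card_fin, nsmul_eq_mul] at this
      rw [← hδm, le_div_iff₀ hm, sub_mul, div_mul_cancel₀ _ hm.ne']
      linarith
    have h2 : Real.sqrt ((1 + (8 * ε + δ)) / 2) ≤ signAmplitude s :=
      Real.sqrt_le_sqrt (by linarith)
    have h3 := sqrt_add_le_sqrt hε hδ0 (hbδ ▸ hb1)
    have hd : Disjoint S (Set.Ioo (signAmplitude s - ε) (signAmplitude s + ε)) := by
      rw [Set.disjoint_left]
      rintro x (hx : x < _) ⟨hx', _⟩
      linarith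
    have h4 := (prob_union_of_disjoint (X s j) hd alg ψ).ge.trans
      (prob_mono (X s j) (Set.subset_univ _) alg ψ)
    rw [htot s j] at h4
    linarith [hsolve s j]
  have hfrac : (m : ℝ) / (4 * Real.sqrt m) ^ 2 = 1 / 16 := by
    rw [mul_pow, hrm]; field_simp; norm_num
  set P : ℝ := 2 ^ m with hP
  have hP0 : 0 < P := by positivity
  have hdev : ∀ b' : ℝ, 0 ≤ b' → b' ≤ 1 →
      ∑ s : Fin m → Fin 2 with 4 * Real.sqrt m ≤ |∑ i, (bitSign (s i) - b')|,
        signDensity b' Finset.univ s ≤ 1 / 16 * P := by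
    intro b' h0 h1
    have := sum_signDensity_deviation_le (ι := Fin m) h0 h1 (t := 4 * Real.sqrt m) (by positivity)
    rwa [Fintype.card_fin, hfrac] at this
  have hmass : ∀ b' : ℝ, ∑ s : Fin m → Fin 2, signDensity b' Finset.univ s = P := by
    intro b'
    rw [sum_signDensity, Fintype.card_fin]
  have hsum0 : 99 / 100 * P - 1 / 16 * P ≤ ∑ s, p s := by
    have h1 := hdev 0 le_rfl zero_le_one
    have h2 : ∑ s : Fin m → Fin 2, (99 / 100 * signDensity 0 Finset.univ s
        - if 4 * Real.sqrt m ≤ |∑ i, (bitSign (s i) - 0)| then signDensity 0 Finset.univ s else 0)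
        ≤ ∑ s, p s := by
      refine Finset.sum_le_sum fun s _ => ?_
      have hone : signDensity 0 Finset.univ s = 1 := by simp [signDensity]
      rw [hone]
      split_ifs with hs
      · linarith [hp0 s]
      · linarith [hlow s (not_le.mp hs)]
    rw [Finset.sum_sub_distrib, ← Finset.mul_sum, hmass, ← Finset.sum_filter] at h2
    linarith
  have hsumb : ∑ s, p s * signDensity b Finset.univ s ≤ 1 / 100 * P + 1 / 16 * P := by
    have h1 := hdev b hb0 hb1
    have h2 : ∑ s, p s * signDensity b Finset.univ s
        ≤ ∑ s : Fin m → Fin 2, (1 / 100 * signDensity b Finset.univ s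
        + if 4 * Real.sqrt m ≤ |∑ i, (bitSign (s i) - b)| then signDensity b Finset.univ s else 0)
        := by
      refine Finset.sum_le_sum fun s _ => ?_
      have hD := signDensity_nonneg hb0 hb1 Finset.univ s
      split_ifs with hs
      · linarith [mul_le_mul_of_nonneg_right (hp1 s) hD]
      · linarith [mul_le_mul_of_nonneg_right (hhigh s (not_le.mp hs)) hD]
    rw [Finset.sum_add_distrib, ← Finset.mul_sum, hmass, ← Finset.sum_filter] at h2
    linarith
  have hchi := sq_sum_average_prob_sub_le alg (N := N) (by omega) (by omega) (flaggedRow F)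
    (fun j s => hX s j) S hψ (p := p) (fun s => by
      simp only [p]
      rw [mul_div_cancel₀ _ hcard.ne']) hb0
  rw [Fintype.card_fin, ← hP] at hchi
  have hpow : (1 + b ^ 2) ^ alg.queries ≤ Real.exp (b ^ 2 * alg.queries) := by
    rw [mul_comm, Real.exp_nat_mul]
    gcongr
    linarith [Real.add_one_le_exp (b ^ 2)]
  -- For `b² T < 1/4` the `χ²` bound is below `1/3 < (4/5)²`.
  by_contra hlt
  have hexp : Real.exp (b ^ 2 * alg.queries) ≤ 4 / 3 := by
    have h1 := Real.exp_le_exp.mpr (not_le.mp hlt).le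
    have h2 := Real.add_one_le_exp (-(1 / 4) : ℝ)
    rw [Real.exp_neg] at h2
    have h3 := Real.exp_pos (1 / 4 : ℝ)
    have h4 : (-(1 / 4) + 1) * Real.exp (1 / 4 : ℝ) ≤ 1 := by
      rwa [← le_div_iff₀ h3, one_div (Real.exp _)]
    linarith
  have hgap : 4 / 5 * P ≤ ∑ s, p s - ∑ s, p s * signDensity b Finset.univ s := by linarith
  have hgap2 : (4 / 5 * P) ^ 2 ≤
      (∑ s, p s * signDensity b Finset.univ s - ∑ s, p s) ^ 2 := by
    rw [← neg_sq (_ - _), neg_sub]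
    gcongr
  have : P ^ 2 * ((1 + b ^ 2) ^ alg.queries - 1) ≤ P ^ 2 * (1 / 3) := by
    gcongr
    linarith
  nlinarith [sq_pos_of_pos hP0]

end ForwardAlgorithm

theorem theorem1p4 :
    ∃ c : ℝ, 0 < c ∧
      ∀ (m : ℕ) [NeZero m] (ε : ℝ), 0 < ε → ε ≤ 1 / 2 →
        ∀ (w : ℕ) [NeZero w] (alg : ForwardAlgorithm (Fin m × Fin 2) (Fin w)),
          alg.SolvesAmplitudeEstimation ε →
            c * min (2 * (m : ℝ)) (1 / ε ^ 2) ≤ (alg.queries : ℝ) := by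
  refine ⟨1 / 1536, by norm_num, fun m _ ε hε hε' w _ alg h => ?_⟩
  have hm : (0 : ℝ) < m := by exact_mod_cast Nat.pos_of_ne_zero (NeZero.ne m)
  have hr : 0 < Real.sqrt m := Real.sqrt_pos.mpr hm
  have hrm : Real.sqrt m ^ 2 = m := Real.sq_sqrt hm.le
  have hT : (1 : ℝ) ≤ alg.queries := by exact_mod_cast h.one_le_queries hε'
  set μ := min (2 * (m : ℝ)) (1 / ε ^ 2) with hμ
  have hμ0 : 0 < μ := lt_min (by positivity) (by positivity)
  have hμm : μ ≤ 2 * m := min_le_left _ _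
  have hμε : μ * ε ^ 2 ≤ 1 := by
    rw [← le_div_iff₀ (by positivity)]
    exact min_le_right _ _
  rcases le_or_gt (8 * ε + 8 / Real.sqrt m) 1 with hb | hb
  · have hq := h.quarter_le hε rfl hb
    have hb2 : μ * (8 * ε + 8 / Real.sqrt m) ^ 2 ≤ 384 := by
      have h1 : (8 * ε + 8 / Real.sqrt m) ^ 2 ≤ 128 * ε ^ 2 + 128 / m := by
        have h2 : (8 / Real.sqrt m) ^ 2 = 64 / m := by rw [div_pow, hrm]; norm_num
        have h3 : 128 / (m : ℝ) = 2 * (64 / m) := by ring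
        rw [h3, ← h2]
        nlinarith [sq_nonneg (8 * ε - 8 / Real.sqrt m)]
      have h2 : μ * (128 / m) ≤ 256 := by
        rw [← mul_div_assoc, div_le_iff₀ hm]
        linarith
      calc _ ≤ μ * (128 * ε ^ 2 + 128 / m) := by gcongr
        _ ≤ 384 := by linarith
    have h1 := mul_le_mul_of_nonneg_left hq hμ0.le
    have h2 := mul_le_mul_of_nonneg_right hb2 (zero_le_one.trans hT)
    linarith
  · -- Large `ε` or small `m`: the minimum is bounded, and one query is needed anyway.
    have : μ ≤ 512 := by
      rcases le_or_gt ε (1 / 16) with h1 | h1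
      · have h2 : 1 / 2 < 8 / Real.sqrt m := by linarith
        rw [lt_div_iff₀ hr] at h2
        nlinarith
      · nlinarith
    linarith
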